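/- Let $(X,\mathcal B,\mu)$ be a probability space and $m$ a positive integer. Let $S$ assign to every $x\in X$ a finite set $S(x)\subset X$ with $1\le |S(x)|\le m$ (an $m$-transformation), and write $S^{-1}(B)=\{x\in X: S(x)\cap B\neq\emptyset\}$. Assume that (i) $S$ is measurable: $\{x\in X: |S(x)|=k,\ |S(x)\cap B|=l\}\in\mathcal B$ for all $B\in\mathcal B$ and all integers $k,l\ge 0$; (ii) $S$ preserves $\mu$: $\displaystyle\int_X \frac{|S(x)\cap B|}{|S(x)|}\,d\mu(x)=\mu(B)$ for all $B\in\mathcal B$; (iii) $S$ is ergodic: $S$ is nonsingular (that is, $\mu(S^{-1}(B))=0$ whenever $B\in\mathcal B$ and $\mu(B)=0$), and for every $B\in\mathcal B$ with $B\subset S^{-1}(B)$ and $B^c\subset S^{-1}(B^c)$, one has $\mu(B)=0$ or $\mu(B^c)=0$. For $f:X\to\mathbb R$ put $Uf(x)=\frac1{|S(x)|}\sum_{y\in S(x)}f(y)$ and $A_n(f)=\frac1n\sum_{k=0}^{n-1}U^kf$ for $n\ge1$. Then: (a) For every $f\in L^1(\mu)$, the averages $A_n(f)$ converge $\mu$-a.e.,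 and their limit $f^*$ is a.e. equal to the constant: $f^*(x)=\lim_{n\to\infty}A_n(f)(x)=\int_X f\,d\mu$ for $\mu$-almost every $x\in X$. (b) For every $B\in\mathcal B$ with $\mu(B)>0$ and for $\mu$-almost every $x\in X$, there is an orbit of $x$, i.e. a sequence $x_0=x,x_1,x_2,\dots$ with $x_{n+1}\in S(x_n)$ for all $n\ge0$, such that $x_n\in B$ for infinitely many $n$. -/

import Mathlib

open Filter Topology MeasureTheory

namespace MTrans

variable {X : Type*}

/-- A multivalued transformation with finite images, `S : X → Finset X`, is an
`m`-transformation if `1 ≤ |S(x)| ≤ m` for every `x`. -/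
def IsMTransformation (m : ℕ) (S : X → Finset X) : Prop :=
  ∀ x, 1 ≤ (S x).card ∧ (S x).card ≤ m

/-- `S⁻¹_{k;l}(B) = {x : |S(x)| = k, |S(x) ∩ B| = l}`. -/
def preimageKL (S : X → Finset X) (k l : ℕ) (B : Set X) : Set X :=
  {x | (S x).card = k ∧ ((S x : Set X) ∩ B).ncard = l}

/-- The full preimage `S⁻¹(B) = {x : S(x) ∩ B ≠ ∅}`. -/
def fullPreimage (S : X → Finset X) (B : Set X) : Set X :=
  {x | ((S x : Set X) ∩ B).Nonempty}

/-- The `m`-transformation is measurable if all sets `S⁻¹_{k;l}(B)`, `B` measurable, are. -/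
def IsMeasurable [MeasurableSpace X] (S : X → Finset X) : Prop :=
  ∀ B : Set X, MeasurableSet B → ∀ k l : ℕ, MeasurableSet (preimageKL S k l B)

/-- The stochastic kernel `K(x, B) = |S(x)|⁻¹ ∑_{y ∈ S(x)} χ_B(y)`. -/
noncomputable def K (S : X → Finset X) (x : X) (B : Set X) : ENNReal :=
  ((S x).card : ENNReal)⁻¹ * ∑ y ∈ S x, B.indicator (fun _ => (1 : ENNReal)) y

/-- The set function `Sμ(B) = ∫ K(x, B) dμ(x)`. -/
noncomputable def pushMeasure [MeasurableSpace X] (S : X → Finset X) (μ : Measure X)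
    (B : Set X) : ENNReal :=
  ∫⁻ x, K S x B ∂μ

/-- `S` is a measurable `m`-transformation that preserves `μ`, that is, `Sμ = μ`. -/
structure IsMeasurePreserving [MeasurableSpace X] (m : ℕ) (S : X → Finset X)
    (μ : Measure X) : Prop where
  isMTransformation : IsMTransformation m S
  isMeasurable : IsMeasurable S
  push_eq : ∀ B : Set X, MeasurableSet B → pushMeasure S μ B = μ B

/-- `S` is a measurable `m`-transformation and preimages of null sets are null. -/
structure IsNonsingular [MeasurableSpace X] (m : ℕ) (S : X → Finset X)
    (μ : Measure X) : Prop where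
  isMTransformation : IsMTransformation m S
  isMeasurable : IsMeasurable S
  null_preimage : ∀ B : Set X, MeasurableSet B → μ B = 0 → μ (fullPreimage S B) = 0

/-- A nonsingular `m`-transformation is ergodic if every measurable `B` with
`B \ S⁻¹(B) = Bᶜ \ S⁻¹(Bᶜ) = ∅` is null or conull. -/
structure IsErgodic [MeasurableSpace X] (m : ℕ) (S : X → Finset X)
    (μ : Measure X) : Prop where
  isNonsingular : IsNonsingular m S μ
  null_or_conull : ∀ B : Set X, MeasurableSet B →
    B \ fullPreimage S B = ∅ → Bᶜ \ fullPreimage S Bᶜ = ∅ → μ B = 0 ∨ μ Bᶜ = 0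

/-- The operator `Uf(x) = |S(x)|⁻¹ ∑_{y ∈ S(x)} f(y)`. -/
noncomputable def U (S : X → Finset X) (f : X → ℝ) : X → ℝ :=
  fun x => ((S x).card : ℝ)⁻¹ * ∑ y ∈ S x, f y

/-- The averages `A_n(f) = n⁻¹ ∑_{k<n} U^k f` (for `n ≥ 1`). -/
noncomputable def average (S : X → Finset X) (f : X → ℝ) (n : ℕ) : X → ℝ :=
  fun x => (n : ℝ)⁻¹ * ∑ k ∈ Finset.range n, ((U S)^[k] f) x

/-- `o` is an orbit of `x`: `o 0 = x` and `o (n+1) ∈ S (o n)` for all `n`. -/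
def IsOrbit (S : X → Finset X) (x : X) (o : ℕ → X) : Prop :=
  o 0 = x ∧ ∀ n, o (n + 1) ∈ S (o n)

end MTrans

namespace MTrans

variable {X : Type*} {S : X → Finset X} {m : ℕ}

/-! ### Pointwise algebra of `U`, the averages and the maximal sums -/

section Algebra

/-! `U` is the Markov operator of a kernel preserving `μ`, so Hopf's ergodic theory applies. For
bounded `f`, `F = limsup A_n f` satisfies `F ≤ UF`, because each `S x` is finite and `U A_n f - A_n
f → 0`. As `∫ UF = ∫ F`, equality holds a.e.; the same argument for `F ^ 2` makes the variance of
`F` over `S x` vanish (`ae_eq_of_le_U`). So `F` is constant along `S`, hence a.e. constant by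
ergodicity. The maximal inequality bounds this constant by `∫ f`, and `-f` gives the liminf. The
weak type bound extends convergence to `L¹` by density.

For recurrence, averages of the indicator of `B` have a positive limit, so almost every point can
reach `B` in positive time. Nonsingularity makes the exceptional null set inaccessible from its
complement, so paths to `B` can be concatenated forever. -/

lemma U_mono {f g : X → ℝ} (h : ∀ x, f x ≤ g x) (x : X) : U S f x ≤ U S g x := by
  unfold U
  gcongr
  exact h _

lemma U_add (f g : X → ℝ) : U S (f + g) = U S f + U S g := by
  funext x
  simp [U, Finset.sum_add_distrib, mul_add]

lemma U_smul (c : ℝ) (f : X → ℝ) : U S (c • f) = c • U S f := by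
  funext x
  simp only [U, Pi.smul_apply, smul_eq_mul, ← Finset.mul_sum]
  ring

lemma U_neg (f : X → ℝ) : U S (-f) = -U S f := by
  simpa using U_smul (S := S) (-1) f

lemma U_sum {ι : Type*} (s : Finset ι) (f : ι → X → ℝ) :
    U S (fun x => ∑ i ∈ s, f i x) = fun x => ∑ i ∈ s, U S (f i) x := by
  funext x
  simp only [U, ← Finset.mul_sum]
  rw [Finset.sum_comm]

lemma U_const (hS : IsMTransformation m S) (c : ℝ) : U S (fun _ => c) = fun _ => c := by
  funext x
  have : ((S x).card : ℝ) ≠ 0 := by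
    have := (hS x).1
    positivity
  simp [U, this]

lemma abs_U_le {f g : X → ℝ} (h : ∀ x, |f x| ≤ g x) (x : X) : |U S f x| ≤ U S g x := by
  rw [abs_le]
  constructor
  · rw [show -U S g x = U S (-g) x by rw [U_neg]; rfl]
    exact U_mono (fun y => (abs_le.1 (h y)).1) x
  · exact U_mono (fun y => (abs_le.1 (h y)).2) x

lemma iterate_U_add (f g : X → ℝ) (k : ℕ) : (U S)^[k] (f + g) = (U S)^[k] f + (U S)^[k] g := by
  induction k with
  | zero => rfl
  | succ k ih => simp only [Function.iterate_succ_apply', ih, U_add]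

lemma iterate_U_neg (f : X → ℝ) (k : ℕ) : (U S)^[k] (-f) = -(U S)^[k] f := by
  induction k with
  | zero => rfl
  | succ k ih => simp only [Function.iterate_succ_apply', ih, U_neg]

lemma iterate_U_const (hS : IsMTransformation m S) (c : ℝ) (k : ℕ) :
    (U S)^[k] (fun _ => c) = fun _ => c := by
  induction k with
  | zero => rfl
  | succ k ih => rw [Function.iterate_succ_apply', ih, U_const hS]

lemma abs_iterate_U_le {f g : X → ℝ} (h : ∀ x, |f x| ≤ g x) (k : ℕ) (x : X) :
    |(U S)^[k] f x| ≤ (U S)^[k] g x := by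
  induction k generalizing x with
  | zero => exact h x
  | succ k ih =>
    simp only [Function.iterate_succ_apply']
    exact abs_U_le ih x

lemma abs_iterate_U_le_const (hS : IsMTransformation m S) {f : X → ℝ} {C : ℝ}
    (h : ∀ x, |f x| ≤ C) (k : ℕ) (x : X) : |(U S)^[k] f x| ≤ C := by
  have := abs_iterate_U_le (S := S) (g := fun _ => C) h k x
  rwa [iterate_U_const hS] at this

lemma average_add (f g : X → ℝ) (n : ℕ) (x : X) :
    average S (f + g) n x = average S f n x + average S g n x := by
  simp [average, iterate_U_add, Finset.sum_add_distrib, mul_add]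

lemma average_neg (f : X → ℝ) (n : ℕ) (x : X) : average S (-f) n x = -average S f n x := by
  simp [average, iterate_U_neg]

lemma abs_average_le {f g : X → ℝ} (h : ∀ x, |f x| ≤ g x) (n : ℕ) (x : X) :
    |average S f n x| ≤ average S g n x := by
  unfold average
  rw [abs_mul, abs_of_nonneg (by positivity : (0 : ℝ) ≤ (n : ℝ)⁻¹)]
  gcongr
  exact (Finset.abs_sum_le_sum_abs _ _).trans
    (Finset.sum_le_sum fun k _ => abs_iterate_U_le h k x)

lemma average_const (hS : IsMTransformation m S) (c : ℝ) {n : ℕ} (hn : n ≠ 0) (x : X) :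
    average S (fun _ => c) n x = c := by
  simp [average, iterate_U_const hS, hn]

lemma abs_average_le_const (hS : IsMTransformation m S) {f : X → ℝ} {C : ℝ} (hC : 0 ≤ C)
    (h : ∀ x, |f x| ≤ C) (n : ℕ) (x : X) : |average S f n x| ≤ C := by
  rcases eq_or_ne n 0 with rfl | hn
  · simpa [average] using hC
  · have := abs_average_le (S := S) (g := fun _ => C) h n x
    rwa [average_const hS _ hn] at this

/-- Applying `U` to an average changes it by a telescoping boundary term. -/
lemma U_average (f : X → ℝ) (n : ℕ) (x : X) :
    U S (average S f n) x = average S f n x + (n : ℝ)⁻¹ * ((U S)^[n] f x - f x) := by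
  have h : average S f n = (n : ℝ)⁻¹ • fun x => ∑ k ∈ Finset.range n, ((U S)^[k] f) x := rfl
  rw [h, U_smul, U_sum]
  simp only [Pi.smul_apply, smul_eq_mul, ← mul_add]
  congr 1
  have := Finset.sum_range_succ (fun k => (U S)^[k] f x) n
  rw [Finset.sum_range_succ'] at this
  simp only [Function.iterate_succ_apply', Function.iterate_zero, id] at this
  linarith

/-- `max (0, S_1 g, …, S_n g)` for the partial sums `S_k g = g + U g + ⋯ + U^{k-1} g`, in the
recursive form used in Garsia's proof of the maximal ergodic inequality. -/
noncomputable def maxSum (S : X → Finset X) (g : X → ℝ) : ℕ → X → ℝ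
  | 0 => 0
  | n + 1 => fun x => max 0 (g x + U S (maxSum S g n) x)

lemma maxSum_nonneg (g : X → ℝ) (n : ℕ) (x : X) : 0 ≤ maxSum S g n x := by
  cases n with
  | zero => exact le_rfl
  | succ n => exact le_max_left _ _

lemma maxSum_le_succ (g : X → ℝ) (n : ℕ) (x : X) : maxSum S g n x ≤ maxSum S g (n + 1) x := by
  induction n generalizing x with
  | zero => exact maxSum_nonneg g 1 x
  | succ n ih => exact max_le_max le_rfl (add_le_add le_rfl (U_mono ih x))

/-- A positive maximum is not attained by the entry `0`, so it equals `g + U M` with `M` the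
previous maximum, and `M` only grows with `n`. This is the core of Garsia's argument. -/
lemma maxSum_le_of_pos (g : X → ℝ) (n : ℕ) (x : X) (h : 0 < maxSum S g n x) :
    maxSum S g n x ≤ g x + U S (maxSum S g n) x := by
  cases n with
  | zero => exact absurd h (lt_irrefl _)
  | succ n =>
    have h1 : maxSum S g (n + 1) x = g x + U S (maxSum S g n) x := by
      rcases max_cases 0 (g x + U S (maxSum S g n) x) with h2 | h2
      · exact absurd h (by exact not_lt.2 h2.1.le)
      · exact h2.1
    rw [h1]
    exact add_le_add le_rfl (U_mono (maxSum_le_succ g n) x)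

lemma sum_le_maxSum (g : X → ℝ) (n : ℕ) (x : X) :
    ∑ k ∈ Finset.range n, (U S)^[k] g x ≤ maxSum S g n x := by
  induction n generalizing x with
  | zero => simp [maxSum]
  | succ n ih =>
    refine le_trans ?_ (le_max_right _ _)
    rw [Finset.sum_range_succ', add_comm]
    refine add_le_add le_rfl ?_
    simp only [Function.iterate_succ_apply']
    rw [← congrFun (U_sum (Finset.range n) fun k => (U S)^[k] g) x]
    exact U_mono ih x

lemma maxSum_pos_of_lt_average (hS : IsMTransformation m S) {f : X → ℝ} {c : ℝ} {n : ℕ}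
    (hn : n ≠ 0) {x : X} (h : c < average S f n x) :
    0 < maxSum S (f - fun _ => c) n x := by
  refine lt_of_lt_of_le ?_ (sum_le_maxSum _ n x)
  have h1 : average S (f - fun _ => c) n x = average S f n x - c := by
    rw [sub_eq_add_neg, average_add, average_neg, average_const hS _ hn, sub_eq_add_neg]
  have h2 : 0 < average S (f - fun _ => c) n x := by rw [h1]; linarith
  exact pos_of_mul_pos_right h2 (by positivity)

end Algebra

/-! ### The Markov kernel of `S` and invariance of the integral -/

section Measurability

variable [MeasurableSpace X]

/-- The pair takes countably many values, so any function of the two counts is measurable; full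
preimages and `K` are both of this kind. -/
lemma measurable_card_ncard (hS : IsMeasurable S) {B : Set X} (hB : MeasurableSet B) :
    Measurable fun x => ((S x).card, ((S x : Set X) ∩ B).ncard) := by
  refine measurable_to_countable' fun p => ?_
  convert hS B hB p.1 p.2 using 1
  ext x
  simp [preimageKL, Prod.ext_iff]

lemma measurableSet_fullPreimage (hS : IsMeasurable S) {B : Set X} (hB : MeasurableSet B) :
    MeasurableSet (fullPreimage S B) := by
  have h := (measurable_card_ncard hS hB).snd (measurableSet_Ioi (a := 0))
  convert h using 1
  ext x
  simp only [fullPreimage, Set.mem_ofPred_eq, Set.mem_preimage, Set.mem_Ioi]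
  rw [Set.ncard_pos ((S x).finite_toSet.inter_of_left B)]

omit [MeasurableSpace X] in
lemma K_eq (x : X) (B : Set X) :
    K S x B = ((S x).card : ENNReal)⁻¹ * (((S x : Set X) ∩ B).ncard : ENNReal) := by
  classical
  unfold K
  congr 1
  have h : (S x : Set X) ∩ B = ((S x).filter (· ∈ B) : Finset X) := by
    ext y
    simp
  rw [h, Set.ncard_coe_finset]
  simp [Set.indicator_apply]

lemma measurable_K (hS : IsMeasurable S) {B : Set X} (hB : MeasurableSet B) :
    Measurable fun x => K S x B := by
  simp only [K_eq]
  have h (f : ℕ × ℕ → ENNReal) : Measurable fun x => f ((S x).card, ((S x : Set X) ∩ B).ncard) :=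
    (measurable_of_countable f).comp (measurable_card_ncard hS hB)
  exact h fun p => (p.1 : ENNReal)⁻¹ * (p.2 : ENNReal)

/-- The stochastic kernel `x ↦ |S(x)|⁻¹ ∑_{y ∈ S(x)} δ_y`. -/
noncomputable def kernel (hS : IsMeasurable S) : ProbabilityTheory.Kernel X X where
  toFun x := ((S x).card : ENNReal)⁻¹ • ∑ y ∈ S x, Measure.dirac y
  measurable' := by
    refine Measure.measurable_of_measurable_coe _ fun B hB => ?_
    convert measurable_K hS hB using 2 with x
    simp [K, Measure.dirac_apply' _ hB, Pi.one_def]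

lemma kernel_eq (hS : IsMeasurable S) (x : X) :
    kernel hS x = ((S x).card : ENNReal)⁻¹ • ∑ y ∈ S x, Measure.dirac y := rfl

lemma kernel_apply (hS : IsMeasurable S) (x : X) {B : Set X} (hB : MeasurableSet B) :
    kernel hS x B = K S x B := by
  simp [kernel_eq, K, Measure.dirac_apply' _ hB, Pi.one_def]

lemma isMarkovKernel_kernel (hS : IsMeasurable S) (hm : IsMTransformation m S) :
    ProbabilityTheory.IsMarkovKernel (kernel hS) where
  isProbabilityMeasure x := by
    constructor
    have h : ((S x).card : ENNReal) ≠ 0 := by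
      have := (hm x).1
      exact_mod_cast (by omega : (S x).card ≠ 0)
    rw [kernel_apply hS x MeasurableSet.univ]
    simp [K, ENNReal.inv_mul_cancel h]

lemma integral_kernel (hS : IsMeasurable S) {f : X → ℝ} (hf : Measurable f) (x : X) :
    ∫ y, f y ∂(kernel hS x) = U S f x := by
  rw [kernel_eq, integral_smul_measure, integral_finsetSum_measure]
  · simp [U, integral_dirac' _ _ hf.stronglyMeasurable]
  · exact fun y _ => integrable_dirac' hf.stronglyMeasurable (by simp)

lemma measurable_U (hS : IsMeasurable S) (hm : IsMTransformation m S) {f : X → ℝ}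
    (hf : Measurable f) : Measurable (U S f) := by
  have := isMarkovKernel_kernel hS hm
  simpa only [integral_kernel hS hf] using
    (hf.stronglyMeasurable.integral_kernel (κ := kernel hS)).measurable

variable {μ : Measure X}

lemma kernel_comp (hS : IsMeasurePreserving m S μ) : μ.bind (kernel hS.isMeasurable) = μ := by
  ext B hB
  rw [Measure.bind_apply hB (kernel hS.isMeasurable).aemeasurable, ← hS.push_eq B hB]
  simp only [kernel_apply _ _ hB, pushMeasure]

lemma integral_U (hS : IsMeasurePreserving m S μ) {f : X → ℝ} (hf : Measurable f)
    (hi : Integrable f μ) : ∫ x, U S f x ∂μ = ∫ x, f x ∂μ := by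
  simp only [← integral_kernel hS.isMeasurable hf]
  have h := kernel_comp hS
  rw [Measure.comp_eq_comp_const_apply] at h
  have h1 := ProbabilityTheory.Kernel.integral_comp (η := kernel hS.isMeasurable)
    (κ := ProbabilityTheory.Kernel.const Unit μ) (a := ()) (f := f) (by rwa [h])
  rw [h] at h1
  simpa using h1.symm

lemma integrable_U (hS : IsMeasurePreserving m S μ) {f : X → ℝ} (hf : Measurable f)
    (hi : Integrable f μ) : Integrable (U S f) μ := by
  have h1 : Integrable f (μ.bind (kernel hS.isMeasurable)) := by rwa [kernel_comp hS]
  have h2 := ((Measure.integrable_comp_iff h1.1).1 h1).2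
  simp only [integral_kernel hS.isMeasurable hf.norm] at h2
  refine h2.mono (measurable_U hS.isMeasurable hS.isMTransformation hf).aestronglyMeasurable (ae_of_all _ fun x => ?_)
  exact (abs_U_le (fun _ => le_rfl) x).trans (le_abs_self _)

end Measurability

end MTrans

namespace MTrans

variable {X : Type*} {S : X → Finset X} {m : ℕ} [MeasurableSpace X] {μ : Measure X}

/-! ### Null sets and almost invariant sets -/

section Null

/-- A property that holds almost everywhere holds off a measurable null set whose complement is
mapped into itself by `S`. -/
lemma exists_null_forward_invariant_compl (hN : IsNonsingular m S μ) {P : X → Prop}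
    (hP : ∀ᵐ x ∂μ, P x) :
    ∃ N : Set X, MeasurableSet N ∧ μ N = 0 ∧ (∀ x ∉ N, P x) ∧ ∀ x ∉ N, ∀ y ∈ S x, y ∉ N := by
  -- `A n` consists of the points with a path of length `n` into a measurable null hull of the
  -- exceptional set.
  set A : ℕ → Set X := fun n => (fullPreimage S)^[n] (toMeasurable μ {x | ¬ P x}) with hA
  have hs (n : ℕ) : A (n + 1) = fullPreimage S (A n) := Function.iterate_succ_apply' _ _ _
  have hm (n : ℕ) : MeasurableSet (A n) := by
    induction n with
    | zero => exact measurableSet_toMeasurable _ _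
    | succ n ih =>
      rw [hs]
      exact measurableSet_fullPreimage hN.isMeasurable ih
  have h0 (n : ℕ) : μ (A n) = 0 := by
    induction n with
    | zero => exact (measure_toMeasurable _).trans hP
    | succ n ih =>
      rw [hs]
      exact hN.null_preimage _ (hm n) ih
  refine ⟨⋃ n, A n, MeasurableSet.iUnion hm, measure_iUnion_null h0, fun x hx => ?_,
    fun x hx y hy hyN => ?_⟩
  · by_contra h
    exact hx (Set.mem_iUnion.2 ⟨0, subset_toMeasurable μ _ h⟩)
  · obtain ⟨n, hn⟩ := Set.mem_iUnion.1 hyN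
    exact hx (Set.mem_iUnion.2 ⟨n + 1, by rw [hs]; exact ⟨y, hy, hn⟩⟩)

/-- Ergodicity is stated for exact inclusions, so `B` must be corrected on a null set. The points
that can reach `B \ N` form a set satisfying both inclusions exactly and agreeing with `B` off `N`.
-/
lemma IsErgodic.null_or_conull_of_ae (hE : IsErgodic m S μ) {B : Set X} (hB : MeasurableSet B)
    (h : ∀ᵐ x ∂μ, ∀ y ∈ S x, (y ∈ B ↔ x ∈ B)) : μ B = 0 ∨ μ Bᶜ = 0 := by
  have hN := hE.isNonsingular
  obtain ⟨N, hNm, hN0, hP, hinv⟩ := exists_null_forward_invariant_compl hN h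
  set A : ℕ → Set X := fun n => (fullPreimage S)^[n] (B \ N) with hA
  have hs (n : ℕ) : A (n + 1) = fullPreimage S (A n) := Function.iterate_succ_apply' _ _ _
  have hm (n : ℕ) : MeasurableSet (A n) := by
    induction n with
    | zero => exact hB.diff hNm
    | succ n ih =>
      rw [hs]
      exact measurableSet_fullPreimage hN.isMeasurable ih
  have hne (x : X) : (S x).Nonempty := Finset.card_pos.1 (hN.isMTransformation x).1
  have hAB (n : ℕ) : ∀ x ∈ A n, x ∉ N → x ∈ B := by
    induction n with
    | zero => exact fun x hx _ => hx.1
    | succ n ih =>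
      intro x hx hxN
      rw [hs] at hx
      obtain ⟨y, hy, hyA⟩ := hx
      exact (hP x hxN y hy).1 (ih y hyA (hinv x hxN y hy))
  have key := hE.null_or_conull (⋃ n, A n) (MeasurableSet.iUnion hm) ?_ ?_
  · have hsub : B \ N ⊆ ⋃ n, A n := Set.subset_iUnion A 0
    rcases key with h0 | h0
    · left
      refine measure_mono_null (t := (⋃ n, A n) ∪ N) (fun x hx => ?_) (measure_union_null h0 hN0)
      by_cases hxN : x ∈ N
      · exact Or.inr hxN
      · exact Or.inl (hsub ⟨hx, hxN⟩)
    · right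
      refine measure_mono_null (t := (⋃ n, A n)ᶜ ∪ N) (fun x hx => ?_) (measure_union_null h0 hN0)
      by_cases hxN : x ∈ N
      · exact Or.inr hxN
      · refine Or.inl fun hxA => hx ?_
        obtain ⟨n, hn⟩ := Set.mem_iUnion.1 hxA
        exact hAB n x hn hxN
  · rw [Set.sdiff_eq_empty]
    intro x hx
    obtain ⟨n, hn⟩ := Set.mem_iUnion.1 hx
    cases n with
    | zero =>
      obtain ⟨y, hy⟩ := hne x
      exact ⟨y, hy, Set.mem_iUnion.2 ⟨0, (hP x hn.2 y hy).2 hn.1, hinv x hn.2 y hy⟩⟩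
    | succ n =>
      rw [hs] at hn
      obtain ⟨y, hy, hyA⟩ := hn
      exact ⟨y, hy, Set.mem_iUnion.2 ⟨n, hyA⟩⟩
  · rw [Set.sdiff_eq_empty]
    intro x hx
    obtain ⟨y, hy⟩ := hne x
    refine ⟨y, hy, fun hyA => hx ?_⟩
    obtain ⟨n, hn⟩ := Set.mem_iUnion.1 hyA
    exact Set.mem_iUnion.2 ⟨n + 1, by rw [hs]; exact ⟨y, hy, hn⟩⟩

end Null

/-! ### Rigidity of bounded subharmonic functions -/

section Integrals

lemma integrable_of_bounded [IsFiniteMeasure μ] {f : X → ℝ} (hf : Measurable f) {C : ℝ}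
    (hC : ∀ x, |f x| ≤ C) : Integrable f μ :=
  Integrable.of_bound hf.aestronglyMeasurable C (ae_of_all _ hC)

/-- A bounded subharmonic function is almost everywhere constant along `S`. -/
lemma ae_eq_of_le_U [IsFiniteMeasure μ] (hS : IsMeasurePreserving m S μ) {F : X → ℝ}
    (hF : Measurable F) {C : ℝ} (hC : ∀ x, |F x| ≤ C) (hle : ∀ x, F x ≤ U S F x) :
    ∀ᵐ x ∂μ, ∀ y ∈ S x, F y = F x := by
  -- `U G - G` is a.e. nonnegative and has integral zero.
  have ae_eq {G : X → ℝ} (hG : Measurable G) (hGi : Integrable G μ)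
      (h : ∀ᵐ x ∂μ, G x ≤ U S G x) : ∀ᵐ x ∂μ, U S G x = G x := by
    have hi := (integrable_U hS hG hGi).sub hGi
    have h0 : ∫ x, (U S G - G) x ∂μ = 0 := by
      simp only [Pi.sub_apply]
      rw [integral_sub (integrable_U hS hG hGi) hGi, integral_U hS hG hGi, sub_self]
    have h1 := (integral_eq_zero_iff_of_nonneg_ae (h.mono fun x hx => sub_nonneg.2 hx) hi).1 h0
    exact h1.mono fun x hx => sub_eq_zero.1 hx
  have hFi : Integrable F μ := integrable_of_bounded hF hC
  have hF2 : Measurable fun x => F x ^ 2 := hF.pow_const 2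
  have hF2i : Integrable (fun x => F x ^ 2) μ := by
    refine integrable_of_bounded hF2 (C := C ^ 2) fun x => ?_
    rw [abs_pow]
    exact pow_le_pow_left₀ (abs_nonneg _) (hC x) 2
  have hUF := ae_eq hF hFi (ae_of_all _ hle)
  have hcard (x : X) : (0 : ℝ) < (S x).card := by exact_mod_cast (hS.isMTransformation x).1
  -- Where `UF = F`, the variance of `F` over `S x` is `U(F²) - F²`. Its nonnegativity makes `F²`
  -- subharmonic a.e., so it vanishes a.e.
  have var (x : X) (hx : U S F x = F x) :
      U S (fun y => (F y - F x) ^ 2) x = U S (fun y => F y ^ 2) x - F x ^ 2 := by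
    have e : (fun y => (F y - F x) ^ 2)
        = (fun y => F y ^ 2) + (-(2 * F x)) • F + fun _ => F x ^ 2 := by
      funext y
      simp only [Pi.add_apply, Pi.smul_apply, smul_eq_mul]
      ring
    rw [e, U_add, U_add, U_smul, U_const hS.isMTransformation]
    simp only [Pi.add_apply, Pi.smul_apply, smul_eq_mul, hx]
    ring
  have nonneg (x : X) : 0 ≤ U S (fun y => (F y - F x) ^ 2) x :=
    mul_nonneg (by positivity) (Finset.sum_nonneg fun y _ => sq_nonneg _)
  have hUF2 := ae_eq hF2 hF2i (hUF.mono fun x hx => by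
    have := nonneg x
    rw [var x hx] at this
    linarith)
  filter_upwards [hUF, hUF2] with x h1 h2 y hy
  have h0 : U S (fun y => (F y - F x) ^ 2) x = 0 := by rw [var x h1, h2, sub_self]
  rcases mul_eq_zero.1 h0 with h3 | h3
  · exact absurd h3 (inv_ne_zero (hcard x).ne')
  · have := (Finset.sum_eq_zero_iff_of_nonneg fun y _ => sq_nonneg (F y - F x)).1 h3 y hy
    exact sub_eq_zero.1 (pow_eq_zero_iff two_ne_zero |>.1 this)

/-- Every preimage under `F` of a measurable set is almost invariant, hence null or conull; since
countably many measurable sets separate the reals, `F` is a.e. constant. -/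
lemma IsErgodic.ae_eq_const_of_le_U [IsProbabilityMeasure μ] (hS : IsMeasurePreserving m S μ)
    (hE : IsErgodic m S μ) {F : X → ℝ} (hF : Measurable F) {C : ℝ} (hC : ∀ x, |F x| ≤ C)
    (hle : ∀ x, F x ≤ U S F x) : ∃ c, ∀ᵐ x ∂μ, F x = c := by
  have h := ae_eq_of_le_U hS hF hC hle
  refine exists_eventuallyEq_const_of_forall_separating (l := ae μ) MeasurableSet fun V hV => ?_
  rcases hE.null_or_conull_of_ae (hF hV) (h.mono fun x hx y hy => by
    rw [Set.mem_preimage, Set.mem_preimage, hx y hy]) with h0 | h0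
  · exact Or.inr (measure_eq_zero_iff_ae_notMem.1 h0)
  · left
    have := measure_eq_zero_iff_ae_notMem.1 h0
    exact this.mono fun x hx => not_not.1 hx

end Integrals

/-! ### Maximal inequalities -/

section Maximal

lemma measurable_maxSum (hS : IsMeasurePreserving m S μ) {g : X → ℝ} (hg : Measurable g) (n : ℕ) :
    Measurable (maxSum S g n) := by
  induction n with
  | zero => exact measurable_const
  | succ n ih =>
    exact measurable_const.max (hg.add (measurable_U hS.isMeasurable hS.isMTransformation ih))

lemma integrable_maxSum (hS : IsMeasurePreserving m S μ) {g : X → ℝ} (hg : Measurable g)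
    (hi : Integrable g μ) (n : ℕ) : Integrable (maxSum S g n) μ := by
  induction n with
  | zero => exact integrable_zero _ _ _
  | succ n ih =>
    exact (integrable_zero _ _ _).sup (hi.add (integrable_U hS (measurable_maxSum hS hg n) ih))

lemma measurableSet_maxSum_pos (hS : IsMeasurePreserving m S μ) {g : X → ℝ} (hg : Measurable g)
    (n : ℕ) : MeasurableSet {x | 0 < maxSum S g n x} :=
  measurableSet_lt measurable_const (measurable_maxSum hS hg n)

/-- Hopf's maximal ergodic inequality. -/
lemma setIntegral_maxSum_pos_nonneg (hS : IsMeasurePreserving m S μ) {g : X → ℝ}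
    (hg : Measurable g) (hi : Integrable g μ) (n : ℕ) :
    0 ≤ ∫ x in {x | 0 < maxSum S g n x}, g x ∂μ := by
  set M := maxSum S g n
  have hM : Measurable M := measurable_maxSum hS hg n
  have hMi : Integrable M μ := integrable_maxSum hS hg hi n
  have hUi : Integrable (U S M) μ := integrable_U hS hM hMi
  have hE : MeasurableSet {x | 0 < M x} := measurableSet_maxSum_pos hS hg n
  -- `M - U M` is at most `g` where `M > 0` and at most `0` elsewhere; by invariance its integral is
  -- zero.
  have h1 : ∫ x, (M x - U S M x) ∂μ ≤ ∫ x, {x | 0 < M x}.indicator g x ∂μ := by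
    refine integral_mono (hMi.sub hUi) (hi.indicator hE) fun x => ?_
    by_cases hx : 0 < M x
    · simp only [Set.indicator_of_mem (show x ∈ {x | 0 < M x} from hx)]
      have := maxSum_le_of_pos g n x hx
      linarith
    · simp only [Set.indicator_of_notMem (show x ∉ {x | 0 < M x} from hx)]
      have h2 : 0 ≤ U S M x :=
        mul_nonneg (by positivity) (Finset.sum_nonneg fun y _ => maxSum_nonneg g n y)
      linarith
  rwa [integral_sub hMi hUi, integral_U hS hM hMi, sub_self, integral_indicator hE] at h1

omit [MeasurableSpace X] in
lemma monotone_maxSum_pos (g : X → ℝ) : Monotone fun n => {x | 0 < maxSum S g n x} :=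
  monotone_nat_of_le_succ fun n x hx => lt_of_lt_of_le hx (maxSum_le_succ g n x)

lemma setIntegral_iUnion_maxSum_pos_nonneg (hS : IsMeasurePreserving m S μ) {g : X → ℝ}
    (hg : Measurable g) (hi : Integrable g μ) :
    0 ≤ ∫ x in ⋃ n, {x | 0 < maxSum S g n x}, g x ∂μ :=
  ge_of_tendsto' (tendsto_setIntegral_of_monotone (measurableSet_maxSum_pos hS hg)
    (monotone_maxSum_pos g) hi.integrableOn) (setIntegral_maxSum_pos_nonneg hS hg hi)

/-- The weak type `(1,1)` bound for the maximal function of the averages. -/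
lemma mul_measureReal_average_gt_le [IsFiniteMeasure μ] (hS : IsMeasurePreserving m S μ)
    {h : X → ℝ} (hm : Measurable h) (hi : Integrable h μ) (h0 : ∀ x, 0 ≤ h x) {c : ℝ}
    (hc : 0 ≤ c) :
    c * μ.real {x | ∃ n, n ≠ 0 ∧ c < average S h n x} ≤ ∫ x, h x ∂μ := by
  have hg : Measurable (h - fun _ => c) := hm.sub measurable_const
  have hgi : Integrable (h - fun _ => c) μ := hi.sub (integrable_const c)
  -- For `h - c` this reads `c * μ(E) ≤ ∫_E h`.
  have key := setIntegral_iUnion_maxSum_pos_nonneg hS hg hgi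
  set E := ⋃ n, {x | 0 < maxSum S (h - fun _ => c) n x}
  simp only [Pi.sub_apply] at key
  rw [integral_sub hi.integrableOn (integrable_const c).integrableOn, setIntegral_const,
    smul_eq_mul] at key
  have h1 : ∫ x in E, h x ∂μ ≤ ∫ x, h x ∂μ := setIntegral_le_integral hi (ae_of_all _ h0)
  have h2 : μ.real {x | ∃ n, n ≠ 0 ∧ c < average S h n x} ≤ μ.real E := by
    refine measureReal_mono fun x hx => ?_
    obtain ⟨n, hn, hx⟩ := hx
    exact Set.mem_iUnion.2 ⟨n, maxSum_pos_of_lt_average hS.isMTransformation hn hx⟩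
  have := mul_le_mul_of_nonneg_left h2 hc
  linarith

end Maximal

end MTrans

namespace MTrans

variable {X : Type*} {S : X → Finset X} {m : ℕ} [MeasurableSpace X] {μ : Measure X}

/-! ### Convergence for bounded functions -/

section Bounded

omit [MeasurableSpace X] in
lemma isBoundedUnder_average (hS : IsMTransformation m S) {f : X → ℝ} {C : ℝ} (hC0 : 0 ≤ C)
    (hC : ∀ x, |f x| ≤ C) (x : X) :
    IsBoundedUnder (· ≤ ·) atTop (fun n => average S f n x) ∧
      IsBoundedUnder (· ≥ ·) atTop (fun n => average S f n x) :=
  ⟨isBoundedUnder_of ⟨C, fun n => (abs_le.1 (abs_average_le_const hS hC0 hC n x)).2⟩,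
    isBoundedUnder_of ⟨-C, fun n => (abs_le.1 (abs_average_le_const hS hC0 hC n x)).1⟩⟩

omit [MeasurableSpace X] in
-- Since `S x` is finite, the averages at all its points are eventually below their limsups plus `ε
-- / 2` simultaneously. Passing from `U A_n f` to `A_n f` costs at most `2C / n`.
lemma limsup_average_le_U (hS : IsMTransformation m S) {f : X → ℝ} {C : ℝ} (hC0 : 0 ≤ C)
    (hC : ∀ x, |f x| ≤ C) (x : X) :
    limsup (fun n => average S f n x) atTop ≤
      U S (fun y => limsup (fun n => average S f n y) atTop) x := by
  set F : X → ℝ := fun y => limsup (fun n => average S f n y) atTop with hF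
  refine le_of_forall_pos_le_add fun ε hε => ?_
  have h1 : ∀ᶠ n in atTop, ∀ y ∈ S x, average S f n y < F y + ε / 2 := by
    rw [eventually_all_finset]
    exact fun y _ => eventually_lt_of_limsup_lt (lt_add_of_pos_right _ (half_pos hε))
      (isBoundedUnder_average hS hC0 hC y).1
  have h2 : ∀ᶠ n : ℕ in atTop, (n : ℝ)⁻¹ * (2 * C) < ε / 2 := by
    have : Tendsto (fun n : ℕ => (n : ℝ)⁻¹ * (2 * C)) atTop (𝓝 (0 * (2 * C))) :=
      tendsto_inv_atTop_nhds_zero_nat.mul_const _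
    rw [zero_mul] at this
    exact this.eventually_lt_const (half_pos hε)
  refine limsup_le_of_le (isBoundedUnder_average hS hC0 hC x).2.isCoboundedUnder_le ?_
  filter_upwards [h1, h2] with n h1 h2
  have h3 : U S (average S f n) x ≤ U S (F + fun _ => ε / 2) x := by
    unfold U
    gcongr with y hy
    exact (h1 y hy).le
  rw [U_add, U_const hS, Pi.add_apply, U_average] at h3
  have h4 : -(2 * C) ≤ (U S)^[n] f x - f x := by
    have := (abs_le.1 (abs_iterate_U_le_const hS hC n x)).1
    have := (abs_le.1 (hC x)).2
    linarith
  have h5 := mul_le_mul_of_nonneg_left h4 (by positivity : (0 : ℝ) ≤ (n : ℝ)⁻¹)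
  linarith

lemma measurable_average (hS : IsMeasurePreserving m S μ) {f : X → ℝ} (hf : Measurable f) (n : ℕ) :
    Measurable (average S f n) := by
  have h (k : ℕ) : Measurable ((U S)^[k] f) := by
    induction k with
    | zero => exact hf
    | succ k ih =>
      rw [Function.iterate_succ_apply']
      exact measurable_U hS.isMeasurable hS.isMTransformation ih
  exact (Finset.measurable_fun_sum _ fun k _ => h k).const_mul _

lemma ae_eventually_average_lt [IsProbabilityMeasure μ] (hS : IsMeasurePreserving m S μ)
    (hE : IsErgodic m S μ) {f : X → ℝ} (hf : Measurable f) {C : ℝ} (hC0 : 0 ≤ C)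
    (hC : ∀ x, |f x| ≤ C) :
    ∀ᵐ x ∂μ, ∀ a, ∫ z, f z ∂μ < a → ∀ᶠ n in atTop, average S f n x < a := by
  have hm := hS.isMTransformation
  have hfi : Integrable f μ := integrable_of_bounded hf hC
  obtain ⟨c, hc⟩ := hE.ae_eq_const_of_le_U hS (C := C)
    (F := fun x => limsup (fun n => average S f n x) atTop)
    (Measurable.limsup fun n => measurable_average hS hf n)
    (fun x => abs_le.2 ⟨le_limsup_of_le (isBoundedUnder_average hm hC0 hC x).1 fun b hb => by
        obtain ⟨n, hn⟩ := hb.exists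
        exact (abs_le.1 (abs_average_le_const hm hC0 hC n x)).1.trans hn,
      limsup_le_of_le (isBoundedUnder_average hm hC0 hC x).2.isCoboundedUnder_le
        (Eventually.of_forall fun n => (abs_le.1 (abs_average_le_const hm hC0 hC n x)).2)⟩)
    (limsup_average_le_U hm hC0 hC)
  have hle : c ≤ ∫ z, f z ∂μ := by
    by_contra! hlt
    -- Almost everywhere some average exceeds `a`, so the maximal inequality for `f - a` is over a
    -- conull set and gives `a ≤ ∫ f`, a contradiction.
    obtain ⟨a, ha, hac⟩ := exists_between hlt
    have key := setIntegral_iUnion_maxSum_pos_nonneg hS (g := f - fun _ => a)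
      (hf.sub measurable_const) (hfi.sub (integrable_const a))
    have hmem : ∀ᵐ x ∂μ, x ∈ ⋃ n, {x | 0 < maxSum S (f - fun _ => a) n x} := by
      filter_upwards [hc] with x hx
      have h1 : ∃ᶠ n in atTop, a < average S f n x :=
        frequently_lt_of_lt_limsup (isBoundedUnder_average hm hC0 hC x).2.isCoboundedUnder_le
          (by rwa [hx])
      obtain ⟨n, hn, hn0⟩ := (h1.and_eventually (eventually_ne_atTop 0)).exists
      exact Set.mem_iUnion.2 ⟨n, maxSum_pos_of_lt_average hm hn0 hn⟩
    rw [Measure.restrict_eq_self_of_ae_mem hmem] at key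
    simp only [Pi.sub_apply] at key
    rw [integral_sub hfi (integrable_const a)] at key
    simp only [integral_const, probReal_univ, one_smul] at key
    linarith
  filter_upwards [hc] with x hx a ha
  exact eventually_lt_of_limsup_lt (by rw [hx]; exact hle.trans_lt ha)
    (isBoundedUnder_average hm hC0 hC x).1

lemma ae_tendsto_average_of_bounded [IsProbabilityMeasure μ] (hS : IsMeasurePreserving m S μ)
    (hE : IsErgodic m S μ) {f : X → ℝ} (hf : Measurable f) {C : ℝ} (hC0 : 0 ≤ C)
    (hC : ∀ x, |f x| ≤ C) :
    ∀ᵐ x ∂μ, Tendsto (fun n => average S f n x) atTop (𝓝 (∫ z, f z ∂μ)) := by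
  filter_upwards [ae_eventually_average_lt hS hE hf hC0 hC,
    ae_eventually_average_lt hS hE hf.neg hC0 (f := -f) (fun x => by simpa using hC x)]
    with x h1 h2
  refine tendsto_order.2 ⟨fun a ha => ?_, h1⟩
  have h3 : ∫ z, (-f) z ∂μ < -a := by
    simp only [Pi.neg_apply]
    rw [integral_neg]
    linarith
  filter_upwards [h2 _ h3] with n hn
  rw [average_neg] at hn
  linarith

end Bounded

/-! ### Extension to integrable functions -/

section Integrable

lemma exists_simpleFunc_integral_abs_sub_lt {f : X → ℝ} (hf : Integrable f μ) {δ : ℝ}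
    (hδ : 0 < δ) : ∃ g : SimpleFunc X ℝ, Integrable g μ ∧ ∫ x, |f x - g x| ∂μ < δ := by
  obtain ⟨g, hg, hgL⟩ := (memLp_one_iff_integrable.2 hf).exists_simpleFunc_eLpNorm_sub_lt
    ENNReal.one_ne_top (ENNReal.ofReal_pos.2 hδ).ne'
  have hgi : Integrable g μ := memLp_one_iff_integrable.1 hgL
  refine ⟨g, hgi, ?_⟩
  rw [eLpNorm_one_eq_lintegral_enorm, ← ofReal_integral_norm_eq_lintegral_enorm (hf.sub hgi),
    ENNReal.ofReal_lt_ofReal_iff hδ] at hg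
  exact hg

lemma ae_eventually_abs_average_sub_lt [IsProbabilityMeasure μ] (hS : IsMeasurePreserving m S μ)
    (hE : IsErgodic m S μ) {f : X → ℝ} (hf : Measurable f) (hi : Integrable f μ) {ε : ℝ}
    (hε : 0 < ε) :
    ∀ᵐ x ∂μ, ∀ᶠ n in atTop, |average S f n x - ∫ z, f z ∂μ| < 3 * ε := by
  set E : Set X := {x | ¬ ∀ᶠ n in atTop, |average S f n x - ∫ z, f z ∂μ| < 3 * ε}
  suffices h : ∀ δ, 0 < δ → μ.real E ≤ 0 + δ from
    (measureReal_eq_zero_iff).1 (le_antisymm (le_of_forall_pos_le_add h) measureReal_nonneg)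
  intro δ hδ
  -- The bound `ε` controls `|∫ f - ∫ g|`; the bound `ε * δ` turns the weak type inequality at level
  -- `ε` into `μ(E) ≤ δ`. The three errors in `3 * ε` are `A_n |f - g|`, `|A_n g - ∫ g|` and `|∫ f -
  -- ∫ g|`.
  obtain ⟨g, hgi, hfg⟩ := exists_simpleFunc_integral_abs_sub_lt hi
    (lt_min hε (mul_pos hε hδ) : 0 < min ε (ε * δ))
  obtain ⟨C, hC⟩ := g.exists_forall_norm_le
  have hconv := ae_tendsto_average_of_bounded hS hE g.measurable (abs_nonneg C)
    (fun x => (hC x).trans (le_abs_self C))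
  have hhm : Measurable fun x => |f x - g x| := (hf.sub g.measurable).abs
  have hhi : Integrable (fun x => |f x - g x|) μ := (hi.sub hgi).abs
  have hweak := mul_measureReal_average_gt_le hS hhm hhi (fun x => abs_nonneg _) hε.le
  have hsub : E ≤ᵐ[μ] {x | ∃ n, n ≠ 0 ∧ ε < average S (fun x => |f x - g x|) n x} := by
    filter_upwards [hconv] with x hx hxE
    by_contra hnot
    refine hxE ?_
    have hint : |∫ z, f z ∂μ - ∫ z, g z ∂μ| < ε := by
      rw [← integral_sub hi hgi]
      exact (abs_integral_le_integral_abs).trans_lt (hfg.trans_le (min_le_left _ _))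
    filter_upwards [Metric.tendsto_nhds.1 hx ε hε, eventually_ne_atTop 0] with n hn hn0
    rw [Real.dist_eq] at hn
    have h1 : average S (fun x => |f x - g x|) n x ≤ ε :=
      not_lt.1 fun h => hnot ⟨n, hn0, h⟩
    have h2 : |average S (f - g) n x| ≤ ε :=
      (abs_average_le (g := fun x => |f x - g x|) (fun y => le_rfl) n x).trans h1
    have h3 : average S f n x = average S (f - g) n x + average S g n x := by
      rw [← average_add, sub_add_cancel]
    rw [h3]
    rw [abs_lt] at hn hint ⊢
    rw [abs_le] at h2
    constructor <;> linarith [h2.1, h2.2, hn.1, hn.2, hint.1, hint.2]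
  have hle : μ.real E ≤ μ.real {x | ∃ n, n ≠ 0 ∧ ε < average S (fun x => |f x - g x|) n x} :=
    ENNReal.toReal_mono (measure_ne_top _ _) (measure_mono_ae hsub)
  have h4 : ε * μ.real E ≤ ε * δ :=
    (mul_le_mul_of_nonneg_left hle hε.le).trans
      (hweak.trans (hfg.le.trans (min_le_right _ _)))
  rw [zero_add]
  exact le_of_mul_le_mul_left h4 hε

lemma ae_tendsto_average_of_measurable [IsProbabilityMeasure μ] (hS : IsMeasurePreserving m S μ)
    (hE : IsErgodic m S μ) {f : X → ℝ} (hf : Measurable f) (hi : Integrable f μ) :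
    ∀ᵐ x ∂μ, Tendsto (fun n => average S f n x) atTop (𝓝 (∫ z, f z ∂μ)) := by
  have h : ∀ᵐ x ∂μ, ∀ j : ℕ, ∀ᶠ n in atTop,
      |average S f n x - ∫ z, f z ∂μ| < 3 * (1 / ((j : ℝ) + 1)) :=
    ae_all_iff.2 fun j => ae_eventually_abs_average_sub_lt hS hE hf hi (by positivity)
  filter_upwards [h] with x hx
  refine Metric.tendsto_nhds.2 fun ε hε => ?_
  obtain ⟨j, hj⟩ := exists_nat_one_div_lt (by positivity : 0 < ε / 3)
  filter_upwards [hx j] with n hn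
  rw [Real.dist_eq]
  linarith

/-- The pointwise ergodic theorem for ergodic measure-preserving `m`-transformations. -/
theorem ae_tendsto_average [IsProbabilityMeasure μ] (hS : IsMeasurePreserving m S μ)
    (hE : IsErgodic m S μ) {f : X → ℝ} (hi : Integrable f μ) :
    ∀ᵐ x ∂μ, Tendsto (fun n => average S f n x) atTop (𝓝 (∫ z, f z ∂μ)) := by
  obtain ⟨g, hg, hfg⟩ := hi.aemeasurable
  -- `U` uses point values, so a.e. equality must survive iteration: as `S` never enters `N` from
  -- outside, all iterates of `f` and `g` agree off `N`.
  obtain ⟨N, -, hN0, hP, hinv⟩ := exists_null_forward_invariant_compl hE.isNonsingular hfg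
  have hiter (k : ℕ) : ∀ x ∉ N, (U S)^[k] f x = (U S)^[k] g x := by
    induction k with
    | zero => exact hP
    | succ k ih =>
      intro x hx
      simp only [Function.iterate_succ_apply']
      unfold U at ih ⊢
      rw [Finset.sum_congr rfl fun y hy => ih y (hinv x hx y hy)]
  rw [integral_congr_ae hfg]
  filter_upwards [ae_tendsto_average_of_measurable hS hE hg (hi.congr hfg),
    measure_eq_zero_iff_ae_notMem.1 hN0] with x hx hxN
  refine hx.congr fun n => ?_
  unfold average
  rw [Finset.sum_congr rfl fun k _ => (hiter k x hxN).symm]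

end Integrable

/-! ### Orbits returning to `B` -/

section Recurrence

omit [MeasurableSpace X] in
lemma exists_mem_pos_of_U_pos {f : X → ℝ} {x : X} (h : 0 < U S f x) : ∃ y ∈ S x, 0 < f y := by
  by_contra! hle
  exact absurd h (not_lt.2 (mul_nonpos_of_nonneg_of_nonpos (by positivity)
    (Finset.sum_nonpos hle)))

omit [MeasurableSpace X] in
/-- If every point off `N` can reach `B` and `S` does not lead from the complement of `N` to `N`,
then every point off `N` has an orbit visiting `B` infinitely often. -/
lemma exists_orbit_infinite {B N : Set X} (hinv : ∀ x ∉ N, ∀ y ∈ S x, y ∉ N)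
    (hreach : ∀ x ∉ N, ∃ n, 0 < (U S)^[n + 1] (B.indicator 1) x) {x : X} (hx : x ∉ N) :
    ∃ o : ℕ → X, IsOrbit S x o ∧ {n | o n ∈ B}.Infinite := by
  classical
  -- One less than the least positive length of a path from `z` into `B`. Some successor either lies
  -- in `B` or has smaller `d`, so always following such successors visits `B` again and again.
  let d (z : {z // z ∉ N}) : ℕ := Nat.find (hreach z z.2)
  have step (z : {z // z ∉ N}) :
      ∃ y : {z // z ∉ N}, (y : X) ∈ S z ∧ ((y : X) ∈ B ∨ d y < d z) := by
    have hd : 0 < (U S)^[d z + 1] (B.indicator 1) (z : X) := Nat.find_spec (hreach z z.2)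
    rw [Function.iterate_succ_apply'] at hd
    obtain ⟨y, hy, hpos⟩ := exists_mem_pos_of_U_pos hd
    refine ⟨⟨y, hinv z z.2 y hy⟩, hy, ?_⟩
    rcases h : d z with _ | k
    · left
      rw [h] at hpos
      exact Set.mem_of_indicator_ne_zero hpos.ne'
    · right
      rw [h] at hpos
      exact Nat.lt_succ_of_le (Nat.find_min' _ hpos)
  choose next hnext hstep using step
  let o (n : ℕ) : {z // z ∉ N} := next^[n] ⟨x, hx⟩
  have ho (n : ℕ) : o (n + 1) = next (o n) := Function.iterate_succ_apply' _ _ _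
  refine ⟨fun n => o n, ⟨rfl, fun n => ?_⟩, Set.infinite_of_forall_exists_gt fun n => ?_⟩
  · beta_reduce
    rw [ho]
    exact hnext _
  · induction hk : d (o n) using Nat.strong_induction_on generalizing n with
    | _ k ih =>
      rcases hstep (o n) with hB | hlt
      · exact ⟨n + 1, by rw [Set.mem_ofPred_eq]; beta_reduce; rw [ho]; exact hB, n.lt_succ_self⟩
      · obtain ⟨j, hj, hlt'⟩ := ih (d (o (n + 1))) (by rw [ho, ← hk]; exact hlt) (n + 1) rfl
        exact ⟨j, hj, n.lt_succ_self.trans hlt'⟩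

/-- Otherwise only the term `k = 0` can contribute positively, so the averages of the indicator are
at most its value divided by `n`, and their limit could not be `μ B > 0`. The exponent `n + 1`
excludes the trivial visit at time zero. -/
lemma ae_exists_iterate_U_indicator_pos [IsProbabilityMeasure μ] (hS : IsMeasurePreserving m S μ)
    (hE : IsErgodic m S μ) {B : Set X} (hB : MeasurableSet B) (hpos : 0 < μ B) :
    ∀ᵐ x ∂μ, ∃ n, 0 < (U S)^[n + 1] (B.indicator 1) x := by
  have hi : Integrable (B.indicator (1 : X → ℝ)) μ := (integrable_const (1 : ℝ)).indicator hB
  filter_upwards [ae_tendsto_average hS hE hi] with x hx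
  by_contra! hle
  rw [integral_indicator_one hB] at hx
  have h0 : Tendsto (fun n : ℕ => (n : ℝ)⁻¹ * B.indicator 1 x) atTop (𝓝 (0 * B.indicator 1 x)) :=
    tendsto_inv_atTop_nhds_zero_nat.mul_const _
  have h1 : μ.real B ≤ 0 * B.indicator 1 x := by
    refine le_of_tendsto_of_tendsto hx h0 ?_
    filter_upwards [eventually_ne_atTop 0] with n hn
    obtain ⟨n, rfl⟩ := Nat.exists_eq_succ_of_ne_zero hn
    unfold average
    gcongr
    rw [Finset.sum_range_succ']
    exact add_le_of_nonpos_left (Finset.sum_nonpos fun k _ => hle k)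
  rw [zero_mul] at h1
  exact absurd (ENNReal.toReal_pos hpos.ne' (measure_ne_top _ _)) (not_lt.2 h1)

end Recurrence

end MTrans

theorem mainTheorem8 {X : Type*} [MeasurableSpace X] (μ : Measure X) [IsProbabilityMeasure μ]
    (m : ℕ) (S : X → Finset X)
    (hS : MTrans.IsMeasurePreserving m S μ) (hE : MTrans.IsErgodic m S μ) :
    (∀ f : X → ℝ, Integrable f μ →
      ∀ᵐ x ∂μ, Tendsto (fun n : ℕ => MTrans.average S f n x) atTop (𝓝 (∫ z, f z ∂μ))) ∧
    (∀ B : Set X, MeasurableSet B → 0 < μ B →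
      ∀ᵐ x ∂μ, ∃ o : ℕ → X, MTrans.IsOrbit S x o ∧ {n : ℕ | o n ∈ B}.Infinite) := by
  refine ⟨fun f hf => MTrans.ae_tendsto_average hS hE hf, fun B hB hpos => ?_⟩
  obtain ⟨N, -, hN0, hP, hinv⟩ := MTrans.exists_null_forward_invariant_compl hE.isNonsingular
    (MTrans.ae_exists_iterate_U_indicator_pos hS hE hB hpos)
  filter_upwards [measure_eq_zero_iff_ae_notMem.1 hN0] with x hx
  exact MTrans.exists_orbit_infinite hinv hP hx
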